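/- **Model.** Let $(\mathcal N,\mathcal E)$ be a finite directed graph (nodes and lines of a microgrid), $\mathcal E_R\subseteq\mathcal E$ the lines with switches, and $\mathcal P_n,\mathcal P_{mn}\subseteq\{a,b,c\}$ the phases of node $n$ and of line $(m,n)$. Let $N_G$ be the number of pairs $(\phi,n)$, $\phi\in\mathcal P_n$, at which a conventional distributed generation (DG) unit is located. The decision variables are the line currents $\xi_{mn}=[\Re\{\mathbf i_{mn}\};\Im\{\mathbf i_{mn}\}]\in\mathbb R^{2|\mathcal P_{mn}|}$, stacked in $\xi$, and the powers $(P_{G_n}^\phi,Q_{G_n}^\phi)$ of the DG units (zero where there is no unit). Let $A_n^\phi\xi\in\mathbb R^2$ be the current injected at $(\phi,n)$, i.e. the sum of the phase-$\phi$ currents on the lines leaving $n$ minus the sum of those on the lines entering $n$. With the nominal voltage $M_Ne^{j\varphi_N^\phi}$, $M_N>0$, put $\varphi_n^\phi=M_N[\cos\varphi_N^\phi,\sin\varphi_N^\phi]^T$ and $\bar\varphi_n^\phi=M_N[\sin\varphi_N^\phi,-\cos\varphi_N^\phi]^T$. Let $\mathcal D$ and $\bar{\mathcal D}$ be disjoint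 sets of node-phase pairs (those with renewable sources or loads, and those without). The renewable powers $(P_{E_n,r}^\phi,Q_{E_n,r}^\phi)$, the loads $(P_{L_n}^\phi,Q_{L_n}^\phi)$ and the current approximation errors $\epsilon_n^\phi\in\mathbb R^2$ are random with an arbitrary joint law $\mu$; put $$P_n^\phi=\sum_rP_{E_n,r}^\phi-P_{L_n}^\phi+(\varphi_n^\phi)^T\epsilon_n^\phi,\qquad Q_n^\phi=\sum_rQ_{E_n,r}^\phi-Q_{L_n}^\phi+(\bar\varphi_n^\phi)^T\epsilon_n^\phi .$$ Let $\mathcal X$ be the set of decisions such that the DG powers lie in given boxes $S^{\min}\preceq S_{G_n}^\phi\preceq S^{\max}$, $\Re\{I_{mn}^\phi\}^2+\Im\{I_{mn}^\phi\}^2\le(I_{mn}^{\max})^2$ for all $(m,n)\in\mathcal E$, $\phi\in\mathcal P_{mn}$, and $A_n^\phi\xi=0$ for $(\phi,n)\in\bar{\mathcal D}$. Let $C$ be a cost that is convex on $\mathcal X$, and let $\lambda>0$. (MR2): minimize $C(\xi,\{S_{G_n}^\phi\})+\lambda\sum_{(m,n)\in\mathcal E_R}\|\xi_{mn}\|_2$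 over $\mathcal X$ subject to $$\Pr\nolimits_\mu\big\{(\varphi_n^\phi)^TA_n^\phi\xi-P_{G_n}^\phi\le P_n^\phi,\ (\bar\varphi_n^\phi)^TA_n^\phi\xi-Q_{G_n}^\phi\le Q_n^\phi\ \ \forall(\phi,n)\in\mathcal D\big\}\ge1-\rho .$$ (MR3): given $K$ samples $P_n^\phi(k),Q_n^\phi(k)$, $k=1,\dots,K$, minimize the same objective over $\mathcal X$ subject to, for all $(\phi,n)\in\mathcal D$, $$(\varphi_n^\phi)^TA_n^\phi\xi\le P_{G_n}^\phi+\min_kP_n^\phi(k),\qquad(\bar\varphi_n^\phi)^TA_n^\phi\xi\le Q_{G_n}^\phi+\min_kQ_n^\phi(k).$$ **Proposition.** Let $\rho,\beta\in(0,1)$, $d=N_G+\sum_{(m,n)\in\mathcal E}|\mathcal P_{mn}|$, and let $$K\ \ge\ \Big\lceil 2\rho^{-1}\ln\beta^{-1}+4d+4d\,\rho^{-1}\ln(2\rho^{-1})\Big\rceil .$$ Suppose that the $K$ samples are computed from independent draws of the random quantities with law $\mu$. Then, with probability at least $1-\beta$ over the samples, every optimal solution of (MR3) (if there is one) is feasible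 for (MR2). -/

import Mathlib

/-- The three phases `a, b, c`. -/
abbrev Phase : Type := Fin 3

/-- A multiphase microgrid graph on the nodes `Fin N`: directed lines `lines`, the subset
`switchLines` of lines equipped with controllable switches, and the phases of every line and of
every node. -/
structure Grid (N : ℕ) where
  lines : Finset (Fin N × Fin N)
  switchLines : Finset (Fin N × Fin N)
  switchLines_subset : switchLines ⊆ lines
  linePhases : Fin N × Fin N → Finset Phase
  nodePhases : Fin N → Finset Phase

namespace Grid

variable {N : ℕ}

/-- The pairs (node, phase of that node). -/
abbrev NodePhase (G : Grid N) : Type := Σ n : Fin N, {φ : Phase // φ ∈ G.nodePhases n}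

/-- The pairs (line, phase of that line). -/
abbrev LinePhase (G : Grid N) : Type :=
  Σ e : {e : Fin N × Fin N // e ∈ G.lines}, {φ : Phase // φ ∈ G.linePhases e.1}

/-- The vector `ξ` of all line currents: component `0` is the real part and component `1` the
imaginary part of the current. -/
abbrev Currents (G : Grid N) : Type := G.LinePhase → Fin 2 → ℝ

/-- The injected current `ι = A ξ` at a node and phase, from Kirchhoff's current law: currents on
the outgoing lines carrying this phase minus currents on the incoming ones
(component `0` real part, component `1` imaginary part). -/
def injected (G : Grid N) (ξ : G.Currents) (p : G.NodePhase) (j : Fin 2) : ℝ :=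
  (∑ l : G.LinePhase with l.1.1.1 = p.1 ∧ l.2.1 = p.2.1, ξ l j)
    - ∑ l : G.LinePhase with l.1.1.2 = p.1 ∧ l.2.1 = p.2.1, ξ l j

/-- The Euclidean norm of `ξ_mn`, the real and imaginary parts of all phase currents of a line. -/
noncomputable def lineNorm (G : Grid N) (ξ : G.Currents)
    (e : {e : Fin N × Fin N // e ∈ G.lines}) : ℝ :=
  Real.sqrt (∑ φ : {φ : Phase // φ ∈ G.linePhases e.1}, ∑ j : Fin 2, ξ ⟨e, φ⟩ j ^ 2)

end Grid

/-- The data of a reconfiguration problem on a grid. For vectors indexed by `Fin 2`, component `0`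
is active power (real part) and component `1` is reactive power (imaginary part). -/
structure Microgrid {N : ℕ} (G : Grid N) where
  /-- the node-phase pairs where a conventional distributed generation (DG) unit is located -/
  dg : Finset G.NodePhase
  /-- the box limits of the DG units -/
  Smin : {p : G.NodePhase // p ∈ dg} → Fin 2 → ℝ
  Smax : {p : G.NodePhase // p ∈ dg} → Fin 2 → ℝ
  /-- the number of renewable energy sources at each node and phase -/
  numRES : G.NodePhase → ℕ
  /-- the pairs where renewable generators and/or loads are located -/
  D : Finset G.NodePhase
  /-- the pairs without generation and load, where no current is injected -/
  Dbar : Finset G.NodePhase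
  disjoint_D : Disjoint D Dbar
  /-- the current limits of the lines -/
  Imax : {e : Fin N × Fin N // e ∈ G.lines} → ℝ
  /-- the magnitude of the nominal voltage -/
  M : ℝ
  M_pos : 0 < M
  /-- the angle of the nominal voltage on each phase -/
  angle : Phase → ℝ
  /-- the weight of the group-sparsity regularizer -/
  lam : ℝ
  lam_pos : 0 < lam

namespace Microgrid

variable {N : ℕ} {G : Grid N}

/-- The decision variables: line currents `ξ` and powers `(P_G, Q_G)` of the DG units. -/
abbrev Decision (m : Microgrid G) : Type :=
  G.Currents × ({p : G.NodePhase // p ∈ m.dg} → Fin 2 → ℝ)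

/-- The number `N_G + ∑_{(m,n) ∈ E} |P_mn|`, half the number of real decision variables. -/
def dim (m : Microgrid G) : ℕ := m.dg.card + ∑ e ∈ G.lines, (G.linePhases e).card

/-- A realization of the uncertain quantities: the power `S_E` of every renewable source, the load
`S_L`, and the error `ε` of the approximate current-power relation, at every node and phase. -/
abbrev Realization (m : Microgrid G) : Type :=
  ((p : G.NodePhase) → Fin (m.numRES p) → Fin 2 → ℝ) ×
    (G.NodePhase → Fin 2 → ℝ) × (G.NodePhase → Fin 2 → ℝ)

/-- The power supplied by the DG unit at a node and phase (zero if there is none). -/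
def dgPower (m : Microgrid G) (x : m.Decision) (p : G.NodePhase) (j : Fin 2) : ℝ :=
  if h : p ∈ m.dg then x.2 ⟨p, h⟩ j else 0

/-- For the row `j = 0` the vector `(M cos θ, M sin θ)`, for the row `j = 1` the vector
`(M sin θ, -M cos θ)`, where `M e^{iθ}` is the nominal voltage on the given phase. -/
noncomputable def rot (m : Microgrid G) (φ : Phase) (j : Fin 2) : Fin 2 → ℝ :=
  if j = 0 then ![m.M * Real.cos (m.angle φ), m.M * Real.sin (m.angle φ)]
  else ![m.M * Real.sin (m.angle φ), -(m.M * Real.cos (m.angle φ))]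

/-- The loss-of-load function: its row `j = 0` is
`φᵀ A ξ - P_G - ∑ P_E + P_L - φᵀ ε`, and its row `j = 1` is the reactive counterpart. -/
noncomputable def lossOfLoad (m : Microgrid G) (x : m.Decision) (u : m.Realization)
    (p : G.NodePhase) (j : Fin 2) : ℝ :=
  m.rot p.2.1 j ⬝ᵥ G.injected x.1 p - m.dgPower x p j - (∑ r, u.1 p r j) + u.2.1 p j
    - m.rot p.2.1 j ⬝ᵥ u.2.2 p

/-- The random quantities `∑ P_E - P_L + φᵀ ε` (row `0`) and `∑ Q_E - Q_L + φ̄ᵀ ε` (row `1`). -/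
noncomputable def netSupply (m : Microgrid G) (u : m.Realization) (p : G.NodePhase)
    (j : Fin 2) : ℝ :=
  (∑ r, u.1 p r j) - u.2.1 p j + m.rot p.2.1 j ⬝ᵥ u.2.2 p

/-- The decisions that satisfy the deterministic constraints: box limits of the DG units, current
limits on every phase of every line, and zero injected current on `Dbar`. -/
def deterministicSet (m : Microgrid G) : Set m.Decision :=
  {x | (∀ p j, m.Smin p j ≤ x.2 p j ∧ x.2 p j ≤ m.Smax p j) ∧
    (∀ l : G.LinePhase, x.1 l 0 ^ 2 + x.1 l 1 ^ 2 ≤ m.Imax l.1 ^ 2) ∧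
    (∀ p ∈ m.Dbar, ∀ j, G.injected x.1 p j = 0)}

/-- The feasible set of the chance-constrained problem when the uncertain quantities have
distribution `μ` and the loss-of-load probability threshold is `ρ`. -/
def chanceFeasible (m : Microgrid G) (μ : MeasureTheory.Measure m.Realization) (ρ : ℝ) :
    Set m.Decision :=
  {x | x ∈ m.deterministicSet ∧
    1 - ρ ≤ μ.real {u | ∀ p ∈ m.D, ∀ j, m.lossOfLoad x u p j ≤ 0}}

/-- The feasible set of the scenario problem with samples `u 0, …, u (K - 1)`; the infimum is the
minimum over the samples when `0 < K`. -/
def scenarioFeasible (m : Microgrid G) {K : ℕ} (u : Fin K → m.Realization) :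
    Set m.Decision :=
  {x | x ∈ m.deterministicSet ∧
    ∀ p ∈ m.D, ∀ j,
      m.rot p.2.1 j ⬝ᵥ G.injected x.1 p ≤ m.dgPower x p j + ⨅ k, m.netSupply (u k) p j}

/-- The objective: a cost `C` plus the group-sparsity regularizer `λ ∑ ‖ξ_mn‖₂` over the lines
with switches. -/
noncomputable def objective (m : Microgrid G) (C : m.Decision → ℝ) (x : m.Decision) : ℝ :=
  C x + m.lam *
    ∑ e : {e : Fin N × Fin N // e ∈ G.lines} with e.1 ∈ G.switchLines, G.lineNorm x.1 e

/-- `x` is an optimal solution of the scenario problem with cost `C` and samples `u`. -/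
def IsScenarioOptimal (m : Microgrid G) (C : m.Decision → ℝ) {K : ℕ}
    (u : Fin K → m.Realization) (x : m.Decision) : Prop :=
  x ∈ m.scenarioFeasible u ∧ IsMinOn (m.objective C) (m.scenarioFeasible u) x

end Microgrid

/-! A scenario-feasible decision can lose load at a fresh realization `u` only if some net supply at
`u` lies strictly below all its sampled values, that is, if `u` is a new record. This criterion does
not involve the decision, so it suffices to bound the tail of the record probability `V = μ
(recordSet b w)`; the whole scenario-feasible set is then chance-feasible at once.

Among `K + M` independent points, each given set of `M` consists of records against the other `K`
with probability `E[V ^ M]`, by exchangeability. At most `n.multichoose M` sets can do so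
simultaneously (`card_recordSubsets_le`), whence `choose (K + M) M * E[V ^ M] ≤ multichoose n M`.
Markov's inequality for every `M`, weighted by `2 ^ (-M)` and summed, gives `Pr (V > ρ) ≤ 2 ^ n * (1
- ρ / 2) ^ (K + 1)` for `n ≥ 1` coordinates. Ties only help, so `μ` may be arbitrary.

At most `2 * dim` node-phase pairs depend on the decision, with two rows each. The constraints at
all other pairs are independent of the decision and merge into one event, so `4 * dim + 1`
coordinates suffice however large `D` is. -/

/-! ### Counting sets of records -/

/-- The points that are smaller, in at least one of the coordinates `b i`, than all points of the
sample `w`. -/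
def recordSet {U κ ι : Type*} (b : ι → U → ℝ) (w : κ → U) : Set U :=
  {u | ∃ i, ∀ k, b i u < b i (w k)}

open Classical in
/-- The `k`-element subsets `T` of `S` all of whose points are smaller, in at least one of the
coordinates `b i`, than all points of `S \ T`. -/
noncomputable def recordSubsets {α ι : Type*} (b : ι → α → ℝ) (S : Finset α) (k : ℕ) :
    Finset (Finset α) :=
  (S.powersetCard k).filter fun T => ∀ t ∈ T, ∃ i, ∀ s ∈ S \ T, b i t < b i s

theorem card_recordSubsets_le_choose {α ι : Type*} (b : ι → α → ℝ) (S : Finset α) (k : ℕ) :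
    (recordSubsets b S k).card ≤ S.card.choose k := by
  classical
  exact (Finset.card_filter_le _ _).trans (Finset.card_powersetCard k S).le

theorem mem_recordSubsets {α ι : Type*} [DecidableEq α] {b : ι → α → ℝ} {S : Finset α} {k : ℕ}
    {T : Finset α} :
    T ∈ recordSubsets b S k ↔
      (T ⊆ S ∧ T.card = k) ∧ ∀ t ∈ T, ∃ i, ∀ s ∈ S, s ∉ T → b i t < b i s := by
  simp [recordSubsets, Finset.mem_powersetCard]

/-- Let `x` minimize coordinate `0` on `S`. If `x ∈ T`, deleting `x` from both sets lowers `k`. If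
`x ∉ T`, no point of `T` can beat `x` in coordinate `0`, so this coordinate is dispensable. The two
cases give the Pascal recursion of `multichoose`. -/
theorem card_recordSubsets_le {α : Type*} : ∀ (n k : ℕ) (b : Fin n → α → ℝ) (S : Finset α),
    (recordSubsets b S k).card ≤ n.multichoose k := by
  classical
  intro n k
  induction k generalizing n with
  | zero =>
    intro b S
    rw [Nat.multichoose_zero_right]
    exact (card_recordSubsets_le_choose b S 0).trans (by simp)
  | succ k ihk =>
    induction n with
    | zero =>
      intro b S
      rw [Nat.multichoose_zero_succ, Nat.le_zero, Finset.card_eq_zero,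
        Finset.eq_empty_iff_forall_notMem]
      intro T hT
      rw [mem_recordSubsets] at hT
      obtain ⟨t, ht⟩ : T.Nonempty := Finset.card_pos.1 (by omega)
      exact (hT.2 t ht).choose.elim0
    | succ n ihn =>
      intro b S
      rcases S.eq_empty_or_nonempty with rfl | hS
      · exact (card_recordSubsets_le_choose b ∅ (k + 1)).trans (by simp)
      obtain ⟨x, hxS, hx⟩ := S.exists_min_image (b 0) hS
      have hsub : recordSubsets b S (k + 1) ⊆
          recordSubsets (fun i : Fin n => b i.succ) S (k + 1) ∪
            (recordSubsets b (S.erase x) k).image (insert x) := by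
        intro T hT
        rw [mem_recordSubsets] at hT
        obtain ⟨⟨hTS, hcard⟩, hT⟩ := hT
        rw [Finset.mem_union]
        by_cases hxT : x ∈ T
        · right
          refine Finset.mem_image.2 ⟨T.erase x, ?_, Finset.insert_erase hxT⟩
          rw [mem_recordSubsets]
          refine ⟨⟨Finset.erase_subset_erase x hTS, by
            rw [Finset.card_erase_of_mem hxT, hcard]; rfl⟩, fun t ht => ?_⟩
          obtain ⟨i, hi⟩ := hT t (Finset.mem_of_mem_erase ht)
          refine ⟨i, fun s hs hsT => hi s (Finset.mem_of_mem_erase hs) fun h => hsT ?_⟩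
          exact Finset.mem_erase.2 ⟨Finset.ne_of_mem_erase hs, h⟩
        · left
          rw [mem_recordSubsets]
          refine ⟨⟨hTS, hcard⟩, fun t ht => ?_⟩
          obtain ⟨i, hi⟩ := hT t ht
          refine Fin.cases (motive := fun i => (∀ s ∈ S, s ∉ T → b i t < b i s) → _)
            (fun h0 => ?_) (fun j hj => ⟨j, hj⟩) i hi
          exact absurd (h0 x hxS hxT) (not_lt.2 (hx t (hTS ht)))
      calc (recordSubsets b S (k + 1)).card
          ≤ (recordSubsets (fun i : Fin n => b i.succ) S (k + 1)).card +
              ((recordSubsets b (S.erase x) k).image (insert x)).card :=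
            (Finset.card_le_card hsub).trans (Finset.card_union_le _ _)
        _ ≤ n.multichoose (k + 1) + (n + 1).multichoose k :=
            add_le_add (ihn _ _) (Finset.card_image_le.trans (ihk _ _ _))
        _ = (n + 1).multichoose (k + 1) := (Nat.multichoose_succ_succ n k).symm

/-! ### Moments and tail of the record probability -/

open MeasureTheory in
theorem measurePreserving_comp_perm {U ι : Type*} [Fintype ι] [MeasurableSpace U] (μ : Measure U)
    [SigmaFinite μ] (e : Equiv.Perm ι) :
    MeasurePreserving (fun z : ι → U => z ∘ e) (Measure.pi fun _ => μ) (Measure.pi fun _ => μ) := by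
  have h := measurePreserving_piCongrLeft (fun _ : ι => μ) e.symm
  convert h using 1
  ext z i
  obtain ⟨j, rfl⟩ := e.symm.surjective i
  rw [MeasurableEquiv.coe_piCongrLeft, Equiv.piCongrLeft_apply_apply]
  simp

theorem measurableSet_prod_recordSet {U κ ι : Type*} [Finite ι] [Finite κ] [MeasurableSpace U]
    {b : ι → U → ℝ} (hb : ∀ i, Measurable (b i)) :
    MeasurableSet {q : (κ → U) × U | q.2 ∈ recordSet b q.1} := by
  have := Finite.to_countable (α := ι)
  have := Finite.to_countable (α := κ)
  have hset : {q : (κ → U) × U | q.2 ∈ recordSet b q.1} =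
      ⋃ i, ⋂ k, {q : (κ → U) × U | b i q.2 < b i (q.1 k)} := by
    ext q
    simp [recordSet]
  rw [hset]
  refine MeasurableSet.iUnion fun i => MeasurableSet.iInter fun k => ?_
  have := hb i
  exact measurableSet_lt (by fun_prop) (by fun_prop)

open MeasureTheory in
theorem measurable_measure_recordSet {U κ ι : Type*} [Finite ι] [Finite κ] [MeasurableSpace U]
    (μ : Measure U) [SFinite μ] {b : ι → U → ℝ} (hb : ∀ i, Measurable (b i)) :
    Measurable fun w : κ → U => μ (recordSet b w) :=
  measurable_measure_prodMk_left (measurableSet_prod_recordSet hb)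

open MeasureTheory in
/-- The moments of the probability of a new record are at most those of a beta distribution. -/
theorem choose_mul_lintegral_measure_recordSet_pow_le {U : Type*} [MeasurableSpace U]
    (μ : Measure U) [IsProbabilityMeasure μ] {n : ℕ} {b : Fin n → U → ℝ}
    (hb : ∀ i, Measurable (b i)) (K M : ℕ) :
    ((K + M).choose M : ENNReal) *
        ∫⁻ w : Fin K → U, μ (recordSet b w) ^ M ∂(Measure.pi fun _ => μ) ≤ n.multichoose M := by
  classical
  let π : Measure (Fin K ⊕ Fin M → U) := Measure.pi fun _ => μ
  let E : Finset (Fin K ⊕ Fin M) → Set (Fin K ⊕ Fin M → U) := fun T =>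
    {z | ∀ t ∈ T, ∃ i, ∀ s, s ∉ T → b i (z t) < b i (z s)}
  have hE : ∀ T, MeasurableSet (E T) := by
    intro T
    simp only [E, Set.ofPred_exists, Set.ofPred_forall]
    refine MeasurableSet.iInter fun t => MeasurableSet.iInter fun _ => MeasurableSet.iUnion fun i =>
      MeasurableSet.iInter fun s => MeasurableSet.iInter fun _ => ?_
    have := hb i
    exact measurableSet_lt (by fun_prop) (by fun_prop)
  let T₀ : Finset (Fin K ⊕ Fin M) := Finset.univ.map Function.Embedding.inr
  have hT₀ : T₀.card = M := by simp [T₀]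
  -- Exchangeability: a permutation carrying `T₀` onto `T` preserves the product measure.
  have hperm : ∀ T ∈ Finset.powersetCard M (Finset.univ : Finset (Fin K ⊕ Fin M)),
      π (E T) = π (E T₀) := by
    intro T hT
    rw [Finset.mem_powersetCard] at hT
    let e : {x // x ∈ T₀} ≃ {x // x ∈ T} := Finset.equivOfCardEq (hT₀.trans hT.2.symm)
    let f : Equiv.Perm (Fin K ⊕ Fin M) := e.extendSubtype
    have hf : ∀ x, f x ∈ T ↔ x ∈ T₀ := fun x =>
      ⟨fun h => by_contra fun hx => e.extendSubtype_not_mem x hx h,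
        fun hx => e.extendSubtype_mem x hx⟩
    rw [← (measurePreserving_comp_perm μ f).measure_preimage (hE T₀).nullMeasurableSet]
    congr 1
    ext z
    simp only [E, Set.mem_ofPred_eq, Set.mem_preimage, Function.comp_apply]
    rw [← f.forall_congr_right]
    simp only [hf]
    refine forall_congr' fun t => imp_congr_right fun _ => exists_congr fun i => ?_
    rw [← f.forall_congr_right]
    simp only [hf]
  -- Given the first `K` points `w`, the other `M` are independent and each is a record with
  -- probability `μ (recordSet b w)`.
  have hsplit : π (E T₀) =
      ∫⁻ w : Fin K → U, μ (recordSet b w) ^ M ∂(Measure.pi fun _ => μ) := by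
    have hmp := (measurePreserving_sumPiEquivProdPi (fun _ : Fin K ⊕ Fin M => μ)).symm
    rw [← hmp.measure_preimage (hE T₀).nullMeasurableSet,
      Measure.prod_apply (hmp.measurable (hE T₀))]
    refine lintegral_congr fun w => ?_
    have : Prod.mk w ⁻¹' ((MeasurableEquiv.sumPiEquivProdPi fun _ => U).symm ⁻¹' E T₀) =
        Set.univ.pi fun _ : Fin M => recordSet b w := by
      ext v
      simp [E, T₀, recordSet, MeasurableEquiv.sumPiEquivProdPi, Equiv.sumPiEquivProdPi]
    rw [this, Measure.pi_pi]
    simp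
  calc ((K + M).choose M : ENNReal) *
        ∫⁻ w : Fin K → U, μ (recordSet b w) ^ M ∂(Measure.pi fun _ => μ)
      = ∑ T ∈ Finset.powersetCard M (Finset.univ : Finset (Fin K ⊕ Fin M)), π (E T) := by
        rw [Finset.sum_congr rfl hperm, hsplit]
        simp
    _ = ∫⁻ z, ∑ T ∈ Finset.powersetCard M (Finset.univ : Finset (Fin K ⊕ Fin M)),
          (E T).indicator 1 z ∂π := by
        rw [lintegral_finsetSum _ fun T _ => measurable_one.indicator (hE T)]
        simp only [lintegral_indicator_one (hE _)]
    _ ≤ ∫⁻ _, (n.multichoose M : ENNReal) ∂π := by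
        refine lintegral_mono fun z => ?_
        refine le_trans (le_of_eq ?_) (Nat.cast_le.2
          (card_recordSubsets_le n M (fun i t => b i (z t)) Finset.univ))
        classical
        simp only [Set.indicator_apply, Pi.one_apply]
        rw [Finset.sum_boole]
        congr 2
        ext T
        simp [mem_recordSubsets, E, Finset.mem_powersetCard]
    _ = n.multichoose M := by simp [π]

-- Markov's inequality for the `M`-th moment. With `n + 1` coordinates both binomials become
-- coefficients of negative binomial series, ready for summation over `M`.
open MeasureTheory in
theorem pow_mul_choose_mul_measureReal_le {U : Type*} [MeasurableSpace U]
    (μ : Measure U) [IsProbabilityMeasure μ] {n : ℕ} {b : Fin (n + 1) → U → ℝ}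
    (hb : ∀ i, Measurable (b i)) (K M : ℕ) {ρ : ℝ} (hρ : 0 ≤ ρ) :
    ρ ^ M * (M + K).choose K *
        (Measure.pi fun _ => μ).real {w : Fin K → U | ρ < μ.real (recordSet b w)} ≤
      (M + n).choose n := by
  let π : Measure (Fin K → U) := Measure.pi fun _ => μ
  have hmul := choose_mul_lintegral_measure_recordSet_pow_le μ hb K M
  have hmarkov : ENNReal.ofReal ρ ^ M * π {w | ρ < μ.real (recordSet b w)} ≤
      ∫⁻ w, μ (recordSet b w) ^ M ∂π := by
    refine le_trans ?_ (mul_meas_ge_le_lintegral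
      ((measurable_measure_recordSet μ hb).pow_const M) (ENNReal.ofReal ρ ^ M))
    refine mul_le_mul_right (measure_mono fun w hw => ?_) _
    have hle : ENNReal.ofReal ρ ≤ μ (recordSet b w) :=
      (ENNReal.ofReal_le_iff_le_toReal (measure_ne_top _ _)).2 (le_of_lt hw)
    exact pow_le_pow_left' hle M
  have h := (mul_le_mul_right hmarkov ((K + M).choose M : ENNReal)).trans hmul
  have h' := ENNReal.toReal_mono (ENNReal.natCast_ne_top _) h
  rw [ENNReal.toReal_mul, ENNReal.toReal_mul, ENNReal.toReal_pow, ENNReal.toReal_ofReal hρ,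
    ENNReal.toReal_natCast, ENNReal.toReal_natCast, Nat.multichoose_eq] at h'
  have h1 : (K + M).choose M = (M + K).choose K := by
    rw [add_comm K M, Nat.choose_symm_add]
  have h2 : (n + 1 + M - 1).choose M = (M + n).choose n := by
    rw [show n + 1 + M - 1 = M + n by omega, Nat.choose_symm_add]
  rw [h1, h2] at h'
  calc _ = ((M + K).choose K : ℝ) * (ρ ^ M * π.real {w | ρ < μ.real (recordSet b w)}) := by ring
    _ ≤ _ := h'

open MeasureTheory in
/-- An upper tail bound for the probability of a new record in one of `n + 1` coordinates. -/
theorem measureReal_recordSet_gt_le {U : Type*} [MeasurableSpace U]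
    (μ : Measure U) [IsProbabilityMeasure μ] {n : ℕ} {b : Fin (n + 1) → U → ℝ}
    (hb : ∀ i, Measurable (b i)) (K : ℕ) {ρ : ℝ} (hρ : ρ ∈ Set.Ioo (0 : ℝ) 1) :
    (Measure.pi fun _ => μ).real {w : Fin K → U | ρ < μ.real (recordSet b w)} ≤
      2 ^ (n + 1) * (1 - ρ / 2) ^ (K + 1) := by
  obtain ⟨hρ0, hρ1⟩ := hρ
  set p := (Measure.pi fun _ => μ).real {w : Fin K → U | ρ < μ.real (recordSet b w)} with hp
  -- The weight `(1 / 2) ^ M` makes both series converge: the left sums to `p / (1 - ρ / 2) ^ (K +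
  -- 1)`, the right to `2 ^ (n + 1)`.
  have hs1 := hasSum_choose_mul_geometric_of_norm_lt_one K (r := ρ / 2)
    (by rw [Real.norm_eq_abs, abs_of_pos] <;> linarith)
  have hs2 := hasSum_choose_mul_geometric_of_norm_lt_one n (r := (1 / 2 : ℝ)) (by norm_num)
  have h := hasSum_le (fun M => ?_) (hs1.mul_left p) hs2
  · have hpos : 0 < (1 - ρ / 2) ^ (K + 1) := pow_pos (by linarith) _
    rw [mul_one_div, div_le_iff₀ hpos] at h
    refine h.trans (le_of_eq ?_)
    congr 1
    rw [show (1 : ℝ) - 1 / 2 = 1 / 2 by norm_num, one_div, one_div, inv_pow, inv_inv]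
  · have := mul_le_mul_of_nonneg_right (pow_mul_choose_mul_measureReal_le μ hb K M hρ0.le)
      (show (0 : ℝ) ≤ (1 / 2) ^ M by positivity)
    calc _ = ρ ^ M * (M + K).choose K * p * (1 / 2) ^ M := by
          rw [div_eq_mul_one_div ρ 2, mul_pow]; ring
      _ ≤ _ := this

open MeasureTheory in
theorem measureReal_recordSet_gt_le_of_card_le {U ι : Type*} [MeasurableSpace U] [Fintype ι]
    [Nonempty ι] (μ : Measure U) [IsProbabilityMeasure μ] {n : ℕ} (hn : Fintype.card ι ≤ n + 1)
    {b : ι → U → ℝ} (hb : ∀ i, Measurable (b i)) (K : ℕ) {ρ : ℝ} (hρ : ρ ∈ Set.Ioo (0 : ℝ) 1) :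
    (Measure.pi fun _ => μ).real {w : Fin K → U | ρ < μ.real (recordSet b w)} ≤
      2 ^ (n + 1) * (1 - ρ / 2) ^ (K + 1) := by
  obtain ⟨e⟩ : Nonempty (ι ↪ Fin (n + 1)) :=
    Function.Embedding.nonempty_of_card_le (by simpa using hn)
  -- Repeating coordinates to reach exactly `n + 1` leaves the record set unchanged.
  have hf : Function.Surjective (Function.invFun e) := Function.invFun_surjective e.injective
  have hset : ∀ w : Fin K → U, recordSet b w = recordSet (fun i => b (Function.invFun e i)) w := by
    intro w
    ext u
    exact (hf.exists (p := fun i => ∀ k, b i u < b i (w k)))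
  simp only [hset]
  exact measureReal_recordSet_gt_le μ (fun i => hb _) K hρ

/-! ### Numerical estimates for the sample size -/

theorem two_pow_mul_one_sub_half_pow_le {ρ β : ℝ} (hρ : ρ ∈ Set.Ioo (0 : ℝ) 1) (hβ : 0 < β)
    {d K : ℕ} (hd : 1 ≤ d)
    (hK : 2 * ρ⁻¹ * Real.log β⁻¹ + 4 * (d : ℝ) + 4 * (d : ℝ) * ρ⁻¹ * Real.log (2 * ρ⁻¹) ≤ K) :
    2 ^ (4 * d + 1) * (1 - ρ / 2) ^ (K + 1) ≤ β := by
  obtain ⟨hρ0, hρ1⟩ := hρ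
  have hd' : (1 : ℝ) ≤ d := by exact_mod_cast hd
  have hlog2 : Real.log 2 < 0.6931471808 := Real.log_two_lt_d9
  have hρK : 2 * Real.log β⁻¹ + 4 * d * ρ + 4 * d * (Real.log 2 - Real.log ρ) ≤ ρ * K := by
    have h := mul_le_mul_of_nonneg_left hK hρ0.le
    rw [Real.log_mul two_ne_zero (inv_ne_zero hρ0.ne'), Real.log_inv ρ] at h
    refine le_trans (le_of_eq ?_) h
    field_simp
    ring
  have h1 : Real.log ρ ≤ ρ - 1 := Real.log_le_sub_one_of_pos hρ0
  -- Tangent at `ρ = 4 / 5`, slightly weakened by `log (5 / 4) ≥ 1 / 5`. It settles `d = 1`, where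
  -- `2 * log ρ ≤ 5 / 2 * ρ - 3 * log 2` is needed; `h1` handles the remaining `d - 1` units.
  have h2 : Real.log ρ ≤ 5 / 4 * ρ - 6 / 5 := by
    have ha := Real.log_le_sub_one_of_pos (show 0 < 5 / 4 * ρ by linarith)
    have hb := Real.log_le_sub_one_of_pos (show (0 : ℝ) < (5 / 4)⁻¹ by norm_num)
    rw [Real.log_mul (by norm_num) hρ0.ne'] at ha
    rw [Real.log_inv] at hb
    norm_num at hb
    linarith
  have hexp : (1 - ρ / 2) ^ (K + 1) ≤ Real.exp (-(ρ / 2) * (K + 1)) := by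
    have h := pow_le_pow_left₀ (by linarith) (Real.one_sub_le_exp_neg (ρ / 2)) (K + 1)
    rw [← Real.exp_nat_mul] at h
    refine h.trans (le_of_eq ?_)
    push_cast
    ring_nf
  have htwo : (2 : ℝ) ^ (4 * d + 1) = Real.exp ((4 * d + 1) * Real.log 2) := by
    rw [← Real.exp_log two_pos, ← Real.exp_nat_mul, Real.exp_log two_pos]
    push_cast
    rfl
  calc (2 : ℝ) ^ (4 * d + 1) * (1 - ρ / 2) ^ (K + 1)
      ≤ Real.exp ((4 * d + 1) * Real.log 2) * Real.exp (-(ρ / 2) * (K + 1)) := by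
        rw [htwo]
        gcongr
    _ = Real.exp ((4 * d + 1) * Real.log 2 - ρ / 2 * (K + 1)) := by
        rw [← Real.exp_add]
        ring_nf
    _ ≤ Real.exp (Real.log β) := by
        rw [Real.exp_le_exp]
        rw [Real.log_inv] at hρK
        have h3 : 0 ≤ ((d : ℝ) - 1) * (ρ - 1 - Real.log ρ) :=
          mul_nonneg (by linarith) (by linarith)
        nlinarith
    _ = β := Real.exp_log hβ

theorem one_sub_pow_le {ρ β : ℝ} (hρ : ρ ∈ Set.Ioo (0 : ℝ) 1) (hβ : β ∈ Set.Ioo (0 : ℝ) 1)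
    {K : ℕ} (hK : 2 * ρ⁻¹ * Real.log β⁻¹ ≤ K) : (1 - ρ) ^ K ≤ β := by
  have hlog : 0 < Real.log β⁻¹ := Real.log_pos ((one_lt_inv₀ hβ.1).2 hβ.2)
  have hρK : 2 * Real.log β⁻¹ ≤ ρ * K := by
    have h := mul_le_mul_of_nonneg_left hK hρ.1.le
    refine le_trans (le_of_eq ?_) h
    have := hρ.1.ne'
    field_simp
  calc (1 - ρ) ^ K ≤ Real.exp (-ρ) ^ K :=
        pow_le_pow_left₀ (by linarith [hρ.2]) (Real.one_sub_le_exp_neg ρ) K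
    _ = Real.exp (-(ρ * K)) := by
        rw [← Real.exp_nat_mul]
        ring_nf
    _ ≤ Real.exp (Real.log β) := by
        rw [Real.log_inv] at hρK hlog
        rw [Real.exp_le_exp]
        linarith
    _ = β := Real.exp_log hβ.1

/-! ### Loss of load as a record event -/

namespace Microgrid

variable {N : ℕ} {G : Grid N} (m : Microgrid G)

open Classical in
/-- The node-phase pairs with a DG unit or incident to a line that carries the phase: elsewhere the
decision variables do not enter the loss-of-load function. -/
noncomputable def activePairs : Finset G.NodePhase :=
  {p | p ∈ m.dg ∨ ∃ l : G.LinePhase, (l.1.1.1 = p.1 ∨ l.1.1.2 = p.1) ∧ l.2.1 = p.2.1}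

theorem mem_activePairs {p : G.NodePhase} : p ∈ m.activePairs ↔
    p ∈ m.dg ∨ ∃ l : G.LinePhase, (l.1.1.1 = p.1 ∨ l.1.1.2 = p.1) ∧ l.2.1 = p.2.1 := by
  simp [activePairs]

theorem card_linePhase (G : Grid N) :
    Fintype.card G.LinePhase = ∑ e ∈ G.lines, (G.linePhases e).card := by
  simp only [Fintype.card_sigma, Fintype.card_coe]
  exact Finset.sum_coe_sort G.lines fun e => (G.linePhases e).card

/-- Each DG unit accounts for one pair, each line phase for its two end nodes. -/
theorem card_activePairs_le : m.activePairs.card ≤ 2 * m.dim := by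
  classical
  let ψ : G.NodePhase → Fin N × Phase := fun p => (p.1, p.2.1)
  have hψ : Function.Injective ψ := by
    rintro ⟨n, φ, hφ⟩ ⟨n', φ', hφ'⟩ h
    simp only [ψ, Prod.mk.injEq] at h
    obtain ⟨rfl, rfl⟩ := h
    rfl
  have hsub : m.activePairs.image ψ ⊆ m.dg.image ψ ∪
      (Finset.univ.image (fun l : G.LinePhase => (l.1.1.1, l.2.1)) ∪
        Finset.univ.image (fun l : G.LinePhase => (l.1.1.2, l.2.1))) := by
    intro q hq
    obtain ⟨p, hp, rfl⟩ := Finset.mem_image.1 hq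
    rw [mem_activePairs] at hp
    rcases hp with hp | ⟨l, hl | hl, hφ⟩
    · exact Finset.mem_union_left _ (Finset.mem_image_of_mem ψ hp)
    · refine Finset.mem_union_right _ (Finset.mem_union_left _ (Finset.mem_image.2 ⟨l, ?_, ?_⟩))
      · exact Finset.mem_univ l
      · exact Prod.ext hl hφ
    · refine Finset.mem_union_right _ (Finset.mem_union_right _ (Finset.mem_image.2 ⟨l, ?_, ?_⟩))
      · exact Finset.mem_univ l
      · exact Prod.ext hl hφ
  have hcard := (Finset.card_le_card hsub).trans ((Finset.card_union_le _ _).trans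
    (add_le_add Finset.card_image_le ((Finset.card_union_le _ _).trans
      (add_le_add Finset.card_image_le Finset.card_image_le))))
  rw [Finset.card_image_of_injective _ hψ, Finset.card_univ, card_linePhase] at hcard
  unfold dim
  omega

theorem measurable_netSupply (p : G.NodePhase) (j : Fin 2) :
    Measurable fun u => m.netSupply u p j := by
  unfold netSupply
  simp only [dotProduct]
  fun_prop

theorem lossOfLoad_eq (x : m.Decision) (u : m.Realization) (p : G.NodePhase) (j : Fin 2) :
    m.lossOfLoad x u p j =
      m.rot p.2.1 j ⬝ᵥ G.injected x.1 p - m.dgPower x p j - m.netSupply u p j := by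
  unfold lossOfLoad netSupply
  ring

theorem injected_eq_zero {p : G.NodePhase} (hp : p ∉ m.activePairs) (ξ : G.Currents) :
    G.injected ξ p = 0 := by
  rw [mem_activePairs, not_or, not_exists] at hp
  funext j
  unfold Grid.injected
  rw [Finset.sum_eq_zero, Finset.sum_eq_zero, sub_zero]
  · rfl
  · intro l hl
    exact absurd ⟨Or.inr (Finset.mem_filter.1 hl).2.1, (Finset.mem_filter.1 hl).2.2⟩ (hp.2 l)
  · intro l hl
    exact absurd ⟨Or.inl (Finset.mem_filter.1 hl).2.1, (Finset.mem_filter.1 hl).2.2⟩ (hp.2 l)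

theorem dgPower_eq_zero {p : G.NodePhase} (hp : p ∉ m.activePairs) (x : m.Decision) (j : Fin 2) :
    m.dgPower x p j = 0 :=
  dif_neg fun h => hp (m.mem_activePairs.2 (Or.inl h))

/-- The realizations with nonnegative net supply on all pairs that no decision can influence. -/
def passiveSafe : Set m.Realization :=
  {u | ∀ p ∈ m.D, p ∉ m.activePairs → ∀ j, 0 ≤ m.netSupply u p j}

theorem measurableSet_passiveSafe : MeasurableSet m.passiveSafe := by
  simp only [passiveSafe, Set.ofPred_forall]
  refine MeasurableSet.iInter fun p => MeasurableSet.iInter fun _ => MeasurableSet.iInter fun _ =>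
    MeasurableSet.iInter fun j => ?_
  exact measurableSet_le measurable_const (m.measurable_netSupply p j)

theorem le_netSupply_of_mem_scenarioFeasible {K : ℕ} {w : Fin K → m.Realization} {x : m.Decision}
    (hx : x ∈ m.scenarioFeasible w) {p : G.NodePhase} (hp : p ∈ m.D) (j : Fin 2) (k : Fin K) :
    m.rot p.2.1 j ⬝ᵥ G.injected x.1 p - m.dgPower x p j ≤ m.netSupply (w k) p j := by
  have h := hx.2 p hp j
  have h' := ciInf_le (Set.finite_range fun k => m.netSupply (w k) p j).bddBelow k
  linarith

theorem mem_passiveSafe_of_mem_scenarioFeasible {K : ℕ} {w : Fin K → m.Realization}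
    {x : m.Decision} (hx : x ∈ m.scenarioFeasible w) (k : Fin K) : w k ∈ m.passiveSafe := by
  intro p hp hpa j
  have h := m.le_netSupply_of_mem_scenarioFeasible hx hp j k
  rwa [m.injected_eq_zero hpa, m.dgPower_eq_zero hpa, dotProduct_zero, sub_zero] at h

open Classical in
/-- The net supplies that decisions can influence, together with the indicator of
`passiveSafe`. -/
noncomputable def record : Option ({p // p ∈ m.activePairs} × Fin 2) → m.Realization → ℝ
  | none => m.passiveSafe.indicator 1
  | some q => fun u => m.netSupply u q.1 q.2

theorem measurable_record (i) : Measurable (m.record i) := by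
  rcases i with _ | q
  · exact measurable_one.indicator m.measurableSet_passiveSafe
  · exact m.measurable_netSupply q.1 q.2

theorem card_record_index_le :
    Fintype.card (Option ({p // p ∈ m.activePairs} × Fin 2)) ≤ 4 * m.dim + 1 := by
  have := m.card_activePairs_le
  rw [Fintype.card_option, Fintype.card_prod, Fintype.card_coe, Fintype.card_fin]
  omega

theorem lossOfLoad_nonpos_of_notMem_recordSet {K : ℕ} {w : Fin K → m.Realization} {x : m.Decision}
    (hx : x ∈ m.scenarioFeasible w) {u : m.Realization} (hu : u ∉ recordSet m.record w) :
    ∀ p ∈ m.D, ∀ j, m.lossOfLoad x u p j ≤ 0 := by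
  intro p hp j
  by_contra! hlt
  rw [lossOfLoad_eq, sub_pos] at hlt
  refine hu ?_
  by_cases hpa : p ∈ m.activePairs
  · exact ⟨some (⟨p, hpa⟩, j), fun k =>
      hlt.trans_le (m.le_netSupply_of_mem_scenarioFeasible hx hp j k)⟩
  · rw [m.injected_eq_zero hpa, m.dgPower_eq_zero hpa, dotProduct_zero, sub_zero] at hlt
    -- All samples are safe by feasibility, so an unsafe `u` is a record of the indicator: `0 < 1`.
    have hu' : u ∉ m.passiveSafe := fun h => (h p hp hpa j).not_gt hlt
    refine ⟨none, fun k => ?_⟩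
    simp only [record]
    rw [Set.indicator_of_notMem hu',
      Set.indicator_of_mem (m.mem_passiveSafe_of_mem_scenarioFeasible hx k)]
    exact one_pos

open MeasureTheory

theorem mem_chanceFeasible_of_measureReal_recordSet_le (μ : Measure m.Realization)
    [IsProbabilityMeasure μ] {ρ : ℝ} {K : ℕ} {w : Fin K → m.Realization}
    (hw : μ.real (recordSet m.record w) ≤ ρ) {x : m.Decision} (hx : x ∈ m.scenarioFeasible w) :
    x ∈ m.chanceFeasible μ ρ := by
  refine ⟨hx.1, ?_⟩
  have hcover : (Set.univ : Set m.Realization) ⊆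
      {u | ∀ p ∈ m.D, ∀ j, m.lossOfLoad x u p j ≤ 0} ∪ recordSet m.record w := fun u _ =>
    (em (u ∈ recordSet m.record w)).elim Or.inr
      fun h => Or.inl (m.lossOfLoad_nonpos_of_notMem_recordSet hx h)
  have h := (measureReal_mono (μ := μ) hcover).trans (measureReal_union_le _ _)
  rw [probReal_univ] at h
  linarith

/-- If there are no decision variables, then scenario feasibility means that all samples lie in
`passiveSafe`, and chance feasibility that this set has probability at least `1 - ρ`. -/
theorem exists_event_of_dim_eq_zero (μ : Measure m.Realization) [IsProbabilityMeasure μ]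
    (hd : m.dim = 0) {ρ β : ℝ} {K : ℕ} (hβ : (1 - ρ) ^ K ≤ β) (hβ0 : 0 ≤ β) :
    ∃ W : Set (Fin K → m.Realization), MeasurableSet W ∧
      (Measure.pi fun _ => μ).real Wᶜ ≤ β ∧
      ∀ w ∈ W, m.scenarioFeasible w ⊆ m.chanceFeasible μ ρ := by
  have hactive : ∀ p, p ∉ m.activePairs := by
    have h := m.card_activePairs_le
    rw [hd, mul_zero, Nat.le_zero, Finset.card_eq_zero] at h
    simp [h]
  rcases le_or_gt (1 - ρ) (μ.real m.passiveSafe) with h | h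
  · refine ⟨Set.univ, MeasurableSet.univ, by simpa using hβ0, fun w _ x hx => ⟨hx.1, h.trans ?_⟩⟩
    refine measureReal_mono fun u hu p hp j => ?_
    rw [lossOfLoad_eq, m.injected_eq_zero (hactive p), m.dgPower_eq_zero (hactive p),
      dotProduct_zero, sub_zero, zero_sub, neg_nonpos]
    exact hu p hp (hactive p) j
  -- Once one sample is unsafe the scenario problem is infeasible and the inclusion is vacuous.
  · refine ⟨(Set.univ.pi fun _ => m.passiveSafe)ᶜ,
      (MeasurableSet.univ_pi fun _ => m.measurableSet_passiveSafe).compl, ?_,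
      fun w hw x hx => absurd (fun k _ => m.mem_passiveSafe_of_mem_scenarioFeasible hx k) hw⟩
    rw [compl_compl, measureReal_def, Measure.pi_pi, Finset.prod_const, Finset.card_univ,
      Fintype.card_fin, ENNReal.toReal_pow]
    exact (pow_le_pow_left₀ measureReal_nonneg h.le K).trans hβ

theorem exists_event_scenarioFeasible_subset (μ : Measure m.Realization) [IsProbabilityMeasure μ]
    {ρ β : ℝ} (hρ : ρ ∈ Set.Ioo (0 : ℝ) 1) (hβ : β ∈ Set.Ioo (0 : ℝ) 1) {K : ℕ}
    (hK : 2 * ρ⁻¹ * Real.log β⁻¹ + 4 * (m.dim : ℝ)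
      + 4 * (m.dim : ℝ) * ρ⁻¹ * Real.log (2 * ρ⁻¹) ≤ K) :
    ∃ W : Set (Fin K → m.Realization), MeasurableSet W ∧
      (Measure.pi fun _ => μ).real Wᶜ ≤ β ∧
      ∀ w ∈ W, m.scenarioFeasible w ⊆ m.chanceFeasible μ ρ := by
  -- For `dim = 0` the general bound `2 * (1 - ρ / 2) ^ (K + 1)` can exceed `β`; the direct bound
  -- `(1 - ρ) ^ K` replaces it.
  rcases Nat.eq_zero_or_pos m.dim with hd | hd
  · refine m.exists_event_of_dim_eq_zero μ hd (one_sub_pow_le hρ hβ ?_) hβ.1.le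
    simpa [hd] using hK
  · refine ⟨{w | μ.real (recordSet m.record w) ≤ ρ}, ?_, ?_, fun w hw x hx =>
      m.mem_chanceFeasible_of_measureReal_recordSet_le μ hw hx⟩
    · exact measurableSet_le
        (measurable_measure_recordSet μ m.measurable_record).ennreal_toReal measurable_const
    · have hcompl : {w : Fin K → m.Realization | μ.real (recordSet m.record w) ≤ ρ}ᶜ =
          {w | ρ < μ.real (recordSet m.record w)} := by
        ext w
        simp
      rw [hcompl]
      exact (measureReal_recordSet_gt_le_of_card_le μ m.card_record_index_le m.measurable_record K
        hρ).trans (two_pow_mul_one_sub_half_pow_le hρ hβ.1 hd hK)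

end Microgrid

theorem proposition1 {N : ℕ} {G : Grid N} (m : Microgrid G)
    (C : m.Decision → ℝ) (hC : ConvexOn ℝ m.deterministicSet C)
    (μ : MeasureTheory.Measure m.Realization) [MeasureTheory.IsProbabilityMeasure μ]
    (ρ β : ℝ) (hρ : ρ ∈ Set.Ioo (0 : ℝ) 1) (hβ : β ∈ Set.Ioo (0 : ℝ) 1)
    (K : ℕ)
    (hK : ⌈2 * ρ⁻¹ * Real.log β⁻¹ + 4 * (m.dim : ℝ)
      + 4 * (m.dim : ℝ) * ρ⁻¹ * Real.log (2 * ρ⁻¹)⌉₊ ≤ K)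
    {Ω : Type*} [MeasurableSpace Ω] (P : MeasureTheory.Measure Ω)
    [MeasureTheory.IsProbabilityMeasure P]
    (σ : Fin K → Ω → m.Realization) (hσ : ∀ k, Measurable (σ k))
    (hindep : ProbabilityTheory.iIndepFun σ P)
    (hlaw : ∀ k, MeasureTheory.Measure.map (σ k) P = μ) :
    ∃ A : Set Ω, MeasurableSet A ∧ 1 - β ≤ P.real A ∧
      ∀ ω ∈ A, ∀ x : m.Decision,
        m.IsScenarioOptimal C (fun k => σ k ω) x → x ∈ m.chanceFeasible μ ρ := by
  obtain ⟨W, hW, hprob, hsub⟩ :=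
    m.exists_event_scenarioFeasible_subset μ hρ hβ (Nat.ceil_le.1 hK)
  have hmeas : Measurable fun ω k => σ k ω := measurable_pi_lambda _ hσ
  have hpi : P.map (fun ω k => σ k ω) = MeasureTheory.Measure.pi fun _ => μ := by
    rw [(ProbabilityTheory.iIndepFun_iff_map_fun_eq_pi_map fun k => (hσ k).aemeasurable).1 hindep]
    simp only [hlaw]
  refine ⟨(fun ω k => σ k ω) ⁻¹' W, hmeas hW, ?_, fun ω hω x hx => hsub _ hω hx.1⟩
  rw [← MeasureTheory.map_measureReal_apply hmeas hW, hpi]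
  rw [MeasureTheory.probReal_compl_eq_one_sub hW] at hprob
  linarith
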